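/- Let $\ell\in\{0,\tfrac12,1,\tfrac32,\dots\}$. Write $(a)_j=a(a+1)\cdots(a+j-1)$ for the shifted factorial, $U_r$ for the Chebyshev polynomials of the second kind, and $$C^{(\alpha)}_n(x)=\frac{(2\alpha)_n}{n!}\,{}_2F_1\!\left(-n,\,n+2\alpha;\,\alpha+\tfrac12;\,\tfrac{1-x}{2}\right)$$ for the Gegenbauer polynomials. For integers $0\le t\le m\le n\le 2\ell$ put $$\alpha_t(m,n)=\frac{2\ell+1}{n+1}\,\frac{(2\ell-m)!\,m!}{(2\ell)!}\,(-1)^{m-t}\,\frac{(n-2\ell)_{m-t}}{(n+2)_{m-t}}\,\frac{(2\ell+2-t)_t}{t!},$$ and let $W(x)=(W(x)_{n,m})_{n,m=0}^{2\ell}$, $x\in[-1,1]$, be the symmetric $(2\ell+1)\times(2\ell+1)$ matrix with $$W(x)_{n,m}=\sqrt{1-x^2}\,\sum_{t=0}^m\alpha_t(m,n)\,U_{n+m-2t}(x)\quad (m\le n),\qquad W(x)_{n,m}=W(x)_{m,n}\quad (m>n).$$ **(a)** For every $x\in[-1,1]$, $$W(x)=\sqrt{1-x^2}\;L(x)\,T(x)\,L(x)^t,$$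 where $L(x)$ is the unipotent lower triangular $(2\ell+1)\times(2\ell+1)$ matrix with entries, for $0\le m,k\le 2\ell$, $$L(x)_{mk}=\frac{m!\,(2k+1)!}{(m+k+1)!\,k!}\,C^{(k+1)}_{m-k}(x)\quad(k\le m),\qquad L(x)_{mk}=0\quad(k>m)$$ (these entries do not depend on $\ell$), and $T(x)$ is the diagonal matrix with entries, for $0\le k\le 2\ell$, $$T(x)_{kk}=c_k(\ell)\,(1-x^2)^k,\qquad c_k(\ell)=\frac{4^k\,(k!)^4\,(2k+1)}{((2k+1)!)^2}\,\frac{(2\ell+k+1)!\,(2\ell-k)!}{((2\ell)!)^2}.$$ **(b)** Equivalently, for all integers $0\le m\le n\le 2\ell$ one has the polynomial identity $$\sum_{t=0}^m\alpha_t(m,n)\,U_{n+m-2t}(x)=\sum_{k=0}^m\beta_k(m,n)\,(1-x^2)^k\,C^{(k+1)}_{n-k}(x)\,C^{(k+1)}_{m-k}(x),$$ where $$\beta_k(m,n)=\frac{m!}{(m+k+1)!}\,\frac{n!}{(n+k+1)!}\,(k!)^2\,2^{2k}\,(2k+1)\,\frac{(2\ell+k+1)!\,(2\ell-k)!}{(2\ell)!\,(2\ell)!}.$$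 -/

import Mathlib

namespace MVChebyshev

noncomputable section

/-- The shifted factorial `(a)_k = a (a + 1) ⋯ (a + k - 1)`. -/
def poch (a : ℝ) (k : ℕ) : ℝ := (ascPochhammer ℝ k).eval a

/-- The Gegenbauer polynomial
`C_n^{(α)}(x) = (2α)_n / n! · ₂F₁(-n, n + 2α; α + 1/2; (1 - x) / 2)`. -/
def gegenbauer (α : ℝ) (n : ℕ) (x : ℝ) : ℝ :=
  poch (2 * α) n / (n.factorial : ℝ) *
    ordinaryHypergeometric (-(n : ℝ)) ((n : ℝ) + 2 * α) (α + 1 / 2) ((1 - x) / 2)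

/-- `U_r(x)`, the Chebyshev polynomial of the second kind. -/
def chebU (r : ℤ) (x : ℝ) : ℝ := (Polynomial.Chebyshev.U ℝ r).eval x

/-- The coefficient `α_t(m, n)`, used for `t ≤ m ≤ n ≤ N`.
Here and below the half-integer `ℓ` is represented by the natural number `N = 2ℓ`. -/
def alpha (N t m n : ℕ) : ℝ :=
  ((N : ℝ) + 1) / ((n : ℝ) + 1) *
    (((N - m).factorial : ℝ) * (m.factorial : ℝ) / (N.factorial : ℝ)) *
    (-1 : ℝ) ^ (m - t) *
    (poch ((n : ℝ) - (N : ℝ)) (m - t) / poch ((n : ℝ) + 2) (m - t)) *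
    (poch ((N : ℝ) + 2 - (t : ℝ)) t / (t.factorial : ℝ))

/-- The coefficient `β_k(m, n)`, used for `k ≤ m ≤ n ≤ N`. -/
def beta (N k m n : ℕ) : ℝ :=
  (m.factorial : ℝ) / ((m + k + 1).factorial : ℝ) *
    ((n.factorial : ℝ) / ((n + k + 1).factorial : ℝ)) *
    (k.factorial : ℝ) * (k.factorial : ℝ) * (2 : ℝ) ^ (2 * k) * (2 * (k : ℝ) + 1) *
    (((N + k + 1).factorial : ℝ) * ((N - k).factorial : ℝ) /
      ((N.factorial : ℝ) * (N.factorial : ℝ)))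

/-- The sum `∑_{t=0}^m α_t(m, n) U_{n+m-2t}(x)`, used for `m ≤ n`. -/
def chebSum (N m n : ℕ) (x : ℝ) : ℝ :=
  ∑ t ∈ Finset.range (m + 1), alpha N t m n * chebU ((n : ℤ) + (m : ℤ) - 2 * (t : ℤ)) x

/-- The entry `W(x)_{n,m}`: it is `√(1 - x²)` times the Chebyshev sum if `m ≤ n`, and it is
`W(x)_{m,n}` otherwise. -/
def weightEntry (N n m : ℕ) (x : ℝ) : ℝ :=
  Real.sqrt (1 - x ^ 2) * (if m ≤ n then chebSum N m n x else chebSum N n m x)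

/-- The `(2ℓ + 1) × (2ℓ + 1)` matrix weight `W(x)`. -/
def weight (N : ℕ) (x : ℝ) : Matrix (Fin (N + 1)) (Fin (N + 1)) ℂ :=
  Matrix.of fun n m => ((weightEntry N n m x : ℝ) : ℂ)

/-- The entry `L(x)_{m,k}`, which does not depend on `ℓ`. -/
def entryL (m k : ℕ) (x : ℝ) : ℝ :=
  if k ≤ m then
    (m.factorial : ℝ) * ((2 * k + 1).factorial : ℝ) /
        (((m + k + 1).factorial : ℝ) * (k.factorial : ℝ)) *
      gegenbauer ((k : ℝ) + 1) (m - k) x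
  else 0

/-- The matrix `L(x)`. -/
def matL (N : ℕ) (x : ℝ) : Matrix (Fin (N + 1)) (Fin (N + 1)) ℂ :=
  Matrix.of fun m k => ((entryL m k x : ℝ) : ℂ)

/-- The constant `c_k(ℓ)`, used for `k ≤ N`. -/
def coeffC (N k : ℕ) : ℝ :=
  (4 : ℝ) ^ k * (k.factorial : ℝ) ^ 4 * (2 * (k : ℝ) + 1) / ((2 * k + 1).factorial : ℝ) ^ 2 *
    (((N + k + 1).factorial : ℝ) * ((N - k).factorial : ℝ) / (N.factorial : ℝ) ^ 2)

/-- The diagonal matrix `T(x)` with entries `c_k(ℓ) (1 - x²)^k`. -/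
def matT (N : ℕ) (x : ℝ) : Matrix (Fin (N + 1)) (Fin (N + 1)) ℂ :=
  Matrix.diagonal fun k => ((coeffC N k * (1 - x ^ 2) ^ (k : ℕ) : ℝ) : ℂ)

end

end MVChebyshev

namespace MVChebyshev

/-! Write N = 2ℓ and fix n. Part (b) is proved by induction on N: as functions of N and m, both sums
satisfy the same recurrence. On the Gegenbauer side, passing from N to N + 1 multiplies the k-th
term by (N+1)(N+2) - k(k+1), up to the factor (N+1)² (`sizeFactor_succ`). With the normalization
m!/(m+k+1)!, the three-term recurrence in m has right-hand coefficients independent of k and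
produces the factor (m+1)(m+2) - k(k+1) (`scaledGegenbauer_recurrence`). The difference of the two
factors is free of k, so the sum at size N + 1 and row m + 1 is a combination, with coefficients
polynomial in x, of the sums at size N and rows m + 1, m, m - 1. On the Chebyshev side, 2xU_r =
U_{r+1} + U_{r-1} reduces the same recurrence to an identity between coefficients (`alpha_step`).
For m = N the factor (N+1)(N+2) - (m+1)(m+2) vanishes against a formal pole (N-m-1)!, which leaves
an inhomogeneous term: the new summand k = N + 1, a multiple of (1-x²)^{N+1} C^{(N+2)}_{n-N-1}. Its
Chebyshev expansion is `pow_mul_gegenbauer`, and `alpha_succ_diag` matches it. Part (a) is (b) read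
entrywise, after moving constants between L and T. -/

/-! ### Shifted factorials. -/

theorem poch_zero (a : ℝ) : poch a 0 = 1 := by simp [poch]

theorem poch_succ (a : ℝ) (k : ℕ) : poch a (k + 1) = poch a k * (a + k) := by
  simp [poch, ascPochhammer_succ_eval]

theorem poch_add (a : ℝ) (m n : ℕ) : poch a (m + n) = poch a m * poch (a + m) n := by
  simp [poch, ← ascPochhammer_mul]

theorem poch_succ_left (a : ℝ) (k : ℕ) : poch a (k + 1) = a * poch (a + 1) k := by
  rw [add_comm k 1, poch_add, poch_succ, poch_zero]
  simp

theorem poch_pos {a : ℝ} (ha : 0 < a) (k : ℕ) : 0 < poch a k := ascPochhammer_pos k a ha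

theorem poch_natCast_succ (a k : ℕ) :
    poch ((a : ℝ) + 1) k = ((a + k).factorial : ℝ) / (a.factorial : ℝ) := by
  have ha : (a.factorial : ℝ) ≠ 0 := by positivity
  induction k with
  | zero => simp [poch_zero, ha]
  | succ k ih =>
    rw [poch_succ, ih, ← add_assoc, Nat.factorial_succ]
    push_cast
    ring

theorem poch_neg_natCast_eq_zero {n j : ℕ} (h : n < j) : poch (-(n : ℝ)) j = 0 :=
  (ascPochhammer_eval_eq_zero_iff j _).2 ⟨n, h, by simp⟩

/-! ### Gegenbauer polynomials: recurrence, contiguous relation, the case α = 1. -/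

/-- The coefficient of `((1 - x) / 2)^j` in the Gegenbauer polynomial `C_n^{(α)}(x)`. -/
noncomputable def gegenbauerCoeff (α : ℝ) (n j : ℕ) : ℝ :=
  poch (2 * α) (n + j) * poch (-(n : ℝ)) j /
    ((n.factorial : ℝ) * (j.factorial : ℝ) * poch (α + 1 / 2) j)

/-- Since (-n)_j = 0 for j > n, the series may be cut at any K > n; the freedom in K puts
polynomials of different degrees over one common range. -/
theorem gegenbauer_eq_sum (α : ℝ) (n K : ℕ) (h : n < K) (x : ℝ) :
    gegenbauer α n x = ∑ j ∈ Finset.range K, gegenbauerCoeff α n j * ((1 - x) / 2) ^ j := by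
  rw [gegenbauer, ordinaryHypergeometric_eq_tsum]
  dsimp only
  rw [tsum_eq_sum (s := Finset.range K),
    Finset.mul_sum]
  · refine Finset.sum_congr rfl fun j _ => ?_
    rw [gegenbauerCoeff, poch_add, add_comm (2 * α) (n : ℝ)]
    simp only [poch, smul_eq_mul, div_eq_mul_inv, mul_inv]
    ring
  · intro j hj
    have hj' : n < j := by simp at hj; omega
    have := poch_neg_natCast_eq_zero hj'
    rw [poch] at this
    simp [this]

theorem gegenbauerCoeff_recurrence {α : ℝ} (hα : 0 < α) (n j : ℕ) :
    ((n : ℝ) + 2) * gegenbauerCoeff α (n + 2) (j + 1) =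
      2 * ((n : ℝ) + 1 + α) *
        (gegenbauerCoeff α (n + 1) (j + 1) - 2 * gegenbauerCoeff α (n + 1) j) -
      ((n : ℝ) + 2 * α) * gegenbauerCoeff α n (j + 1) := by
  have h1 := (poch_pos (show 0 < α + 1 / 2 by linarith) j).ne'
  have h2 : α + 1 / 2 + j ≠ 0 := by positivity
  have e1 : poch (-(n : ℝ)) (j + 1) =
      poch (-((n : ℝ) + 1)) j * (n + 1 - j) / (n + 1) * (j - n) := by
    have h3 := poch_succ (-((n : ℝ) + 1)) j
    rw [poch_succ_left, show -((n : ℝ) + 1) + 1 = -(n : ℝ) by ring] at h3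
    rw [poch_succ]
    field_simp
    linear_combination -(j - n : ℝ) * h3
  have e2 : poch (-((n : ℝ) + 2)) (j + 1) = -((n : ℝ) + 2) * poch (-((n : ℝ) + 1)) j := by
    rw [poch_succ_left]
    ring_nf
  simp only [gegenbauerCoeff]
  push_cast
  rw [show n + 2 + (j + 1) = n + j + 1 + 1 + 1 by ring, show n + 1 + (j + 1) = n + j + 1 + 1 by ring,
    show n + 1 + j = n + j + 1 by ring, show n + (j + 1) = n + j + 1 by ring, e1, e2,
    poch_succ (-((n : ℝ) + 1)), poch_succ (α + 1 / 2), poch_succ (2 * α) (n + j + 1 + 1),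
    poch_succ (2 * α) (n + j + 1)]
  simp only [Nat.factorial_succ]
  push_cast
  field_simp
  ring

theorem gegenbauerCoeff_recurrence_zero {α : ℝ} (n : ℕ) :
    ((n : ℝ) + 2) * gegenbauerCoeff α (n + 2) 0 =
      2 * ((n : ℝ) + 1 + α) * gegenbauerCoeff α (n + 1) 0 -
      ((n : ℝ) + 2 * α) * gegenbauerCoeff α n 0 := by
  simp only [gegenbauerCoeff, poch_zero, poch_succ, add_zero, Nat.factorial_succ]
  push_cast
  field_simp
  ring

theorem gegenbauer_recurrence {α : ℝ} (hα : 0 < α) (n : ℕ) (x : ℝ) :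
    ((n : ℝ) + 2) * gegenbauer α (n + 2) x =
      2 * ((n : ℝ) + 1 + α) * x * gegenbauer α (n + 1) x -
      ((n : ℝ) + 2 * α) * gegenbauer α n x := by
  obtain ⟨y, rfl⟩ : ∃ y, x = 1 - 2 * y := ⟨(1 - x) / 2, by ring⟩
  have hS : ∑ j ∈ Finset.range (n + 2),
      (((n : ℝ) + 2) * gegenbauerCoeff α (n + 2) (j + 1) * y ^ (j + 1)) =
      ∑ j ∈ Finset.range (n + 2), (2 * ((n : ℝ) + 1 + α) *
        (gegenbauerCoeff α (n + 1) (j + 1) * y ^ (j + 1)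
          - 2 * y * (gegenbauerCoeff α (n + 1) j * y ^ j)) -
      ((n : ℝ) + 2 * α) * (gegenbauerCoeff α n (j + 1) * y ^ (j + 1))) :=
    Finset.sum_congr rfl fun j _ => by
      rw [gegenbauerCoeff_recurrence hα]
      ring
  rw [Finset.sum_sub_distrib, ← Finset.mul_sum, ← Finset.mul_sum, Finset.sum_sub_distrib,
    ← Finset.mul_sum] at hS
  have hy : (1 - (1 - 2 * y)) / 2 = y := by ring
  have g0 := gegenbauer_eq_sum α n (n + 3) (by omega) (1 - 2 * y)
  have g1 := gegenbauer_eq_sum α (n + 1) (n + 3) (by omega) (1 - 2 * y)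
  -- The copy multiplied by y has its index shifted by one, hence the shorter range.
  have g1' := gegenbauer_eq_sum α (n + 1) (n + 2) (by omega) (1 - 2 * y)
  have g2 := gegenbauer_eq_sum α (n + 2) (n + 3) (by omega) (1 - 2 * y)
  rw [hy] at g0 g1 g1' g2
  rw [Finset.sum_range_succ'] at g0 g1 g2
  have h0 := gegenbauerCoeff_recurrence_zero (α := α) n
  simp only [mul_assoc, ← Finset.mul_sum] at hS
  rw [← g1'] at hS
  linear_combination hS + h0 + ((n : ℝ) + 2) * g2 - 2 * ((n : ℝ) + 1 + α) * g1 +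
    ((n : ℝ) + 2 * α) * g0

theorem gegenbauer_zero (α x : ℝ) : gegenbauer α 0 x = 1 := by
  rw [gegenbauer_eq_sum α 0 1 one_pos]
  simp [gegenbauerCoeff, poch_zero]

theorem gegenbauer_one {α : ℝ} (hα : 0 < α) (x : ℝ) : gegenbauer α 1 x = 2 * α * x := by
  have h : α + 1 / 2 ≠ 0 := by positivity
  rw [gegenbauer_eq_sum α 1 2 one_lt_two]
  simp [gegenbauerCoeff, poch_zero, poch_succ, Finset.sum_range_succ]
  field_simp
  ring

/-- The contiguous relation lowering the parameter of a Gegenbauer polynomial. -/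
theorem gegenbauer_contiguous {α : ℝ} (hα : 0 < α) (x : ℝ) (n : ℕ) :
    4 * α * ((n : ℝ) + α + 1) * (1 - x ^ 2) * gegenbauer (α + 1) n x =
      ((n : ℝ) + 2 * α) * ((n : ℝ) + 2 * α + 1) * gegenbauer α n x -
      ((n : ℝ) + 1) * ((n : ℝ) + 2) * gegenbauer α (n + 2) x := by
  have hα' : 0 < α + 1 := by linarith
  induction n using Nat.twoStepInduction with
  | zero =>
    have h := gegenbauer_recurrence hα 0 x
    simp only [zero_add, gegenbauer_zero, gegenbauer_one hα, Nat.cast_zero] at h ⊢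
    linear_combination h
  | one =>
    have h := gegenbauer_recurrence hα 0 x
    have h' := gegenbauer_recurrence hα 1 x
    simp only [zero_add, gegenbauer_zero, gegenbauer_one hα, gegenbauer_one hα', Nat.cast_zero,
      Nat.cast_one] at h h' ⊢
    norm_num at h h' ⊢
    linear_combination 2 * h' + (2 + α) * 2 * x * h
  | more n ih0 ih1 =>
    have r0 := gegenbauer_recurrence hα n x
    have r1 := gegenbauer_recurrence hα (n + 1) x
    have r2 := gegenbauer_recurrence hα (n + 2) x
    have r3 := gegenbauer_recurrence hα' n x
    -- The factor n + 2 clears the leading coefficient of `r3`; n + α + 1 is the factor that `ih0`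
    -- needs.
    have h : ((n : ℝ) + 2) * (n + α + 1) ≠ 0 := by positivity
    apply mul_left_cancel₀ h
    push_cast at ih1 r1 r2 ⊢
    linear_combination 4 * α * ((n : ℝ) + 3 + α) * (n + α + 1) * (1 - x ^ 2) * r3 +
      2 * x * ((n : ℝ) + 3 + α) * (n + α + 1) * ih1 -
      ((n : ℝ) + 3 + α) * (n + 2 * α + 2) * ih0 +
      ((n : ℝ) + 2) * (n + 3) * (n + α + 1) * r2 -
      ((n : ℝ) + 3 + α) * (n + 2 * α + 2) * (n + 2 * α + 1) * r0

theorem gegenbauer_one_eq_chebU (n : ℕ) (x : ℝ) : gegenbauer 1 n x = chebU n x := by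
  induction n using Nat.twoStepInduction with
  | zero => simp [gegenbauer_zero, chebU]
  | one => simp [gegenbauer_one, chebU]
  | more n ih0 ih1 =>
    have h := gegenbauer_recurrence one_pos n x
    have hU : chebU ((n + 2 : ℕ) : ℤ) x = 2 * x * chebU ((n + 1 : ℕ) : ℤ) x - chebU n x := by
      simp [chebU, Polynomial.Chebyshev.U_add_two]
    rw [hU, ← ih0, ← ih1]
    have h2 : (n : ℝ) + 2 ≠ 0 := by positivity
    apply mul_left_cancel₀ h2
    linear_combination h

/-! ### Chebyshev expansions and shifts of their coefficients. -/

theorem two_mul_chebU (r : ℤ) (x : ℝ) : 2 * x * chebU r x = chebU (r + 1) x + chebU (r - 1) x := by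
  simp [chebU, Polynomial.Chebyshev.U_add_one]

/-- The Chebyshev expansion `∑_{t + s = m} c(t, s) U_{r + s - t}(x)`. -/
noncomputable def chebExpansion (c : ℕ → ℕ → ℝ) (r : ℤ) (m : ℕ) (x : ℝ) : ℝ :=
  ∑ p ∈ Finset.HasAntidiagonal.antidiagonal m, c p.1 p.2 * chebU (r + p.2 - p.1) x

/-- Shift of a double sequence in the first index, filled up by zeros. -/
def shiftFst (c : ℕ → ℕ → ℝ) : ℕ → ℕ → ℝ
  | 0, _ => 0
  | t + 1, s => c t s

/-- Shift of a double sequence in the second index, filled up by zeros. -/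
def shiftSnd (c : ℕ → ℕ → ℝ) : ℕ → ℕ → ℝ
  | _, 0 => 0
  | t, s + 1 => c t s

theorem chebExpansion_shiftFst (c : ℕ → ℕ → ℝ) (r : ℤ) (m : ℕ) (x : ℝ) :
    chebExpansion (shiftFst c) r (m + 1) x = chebExpansion c (r - 1) m x := by
  rw [chebExpansion, Finset.Nat.sum_antidiagonal_succ, chebExpansion]
  simp only [shiftFst, zero_mul, zero_add]
  refine Finset.sum_congr rfl fun p _ => ?_
  push_cast
  ring_nf

theorem chebExpansion_shiftSnd (c : ℕ → ℕ → ℝ) (r : ℤ) (m : ℕ) (x : ℝ) :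
    chebExpansion (shiftSnd c) r (m + 1) x = chebExpansion c (r + 1) m x := by
  rw [chebExpansion, Finset.Nat.sum_antidiagonal_succ', chebExpansion]
  simp only [shiftSnd, zero_mul, zero_add]
  refine Finset.sum_congr rfl fun p _ => ?_
  push_cast
  ring_nf

/-- Multiplication by 2x moves s - t by ±1, that is, raises s or t by one, and so raises the level t
+ s. -/
theorem two_mul_chebExpansion (c : ℕ → ℕ → ℝ) (r : ℤ) (m : ℕ) (x : ℝ) :
    2 * x * chebExpansion c r m x =
      chebExpansion (shiftFst c) r (m + 1) x + chebExpansion (shiftSnd c) r (m + 1) x := by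
  rw [chebExpansion_shiftFst, chebExpansion_shiftSnd]
  simp only [chebExpansion, Finset.mul_sum, ← Finset.sum_add_distrib]
  refine Finset.sum_congr rfl fun p _ => ?_
  have h := two_mul_chebU (r + p.2 - p.1) x
  rw [show r - 1 + (p.2 : ℤ) - p.1 = r + p.2 - p.1 - 1 by ring,
    show r + 1 + (p.2 : ℤ) - p.1 = r + p.2 - p.1 + 1 by ring]
  linear_combination c p.1 p.2 * h

/-- Raising both t and s keeps s - t and adds two to the level. The factor m neutralizes the
truncated `m - 1` at m = 0. -/
theorem natCast_mul_chebExpansion_pred (c : ℕ → ℕ → ℝ) (r : ℤ) (m : ℕ) (x : ℝ) :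
    (m : ℝ) * chebExpansion c r (m - 1) x =
      m * chebExpansion (shiftFst (shiftSnd c)) r (m + 1) x := by
  cases m with
  | zero => simp
  | succ m =>
    rw [chebExpansion_shiftFst, chebExpansion_shiftSnd]
    simp

theorem chebExpansion_add (c d : ℕ → ℕ → ℝ) (r : ℤ) (m : ℕ) (x : ℝ) :
    chebExpansion c r m x + chebExpansion d r m x =
      chebExpansion (fun t s => c t s + d t s) r m x := by
  simp only [chebExpansion, ← Finset.sum_add_distrib, add_mul]

theorem chebExpansion_sub (c d : ℕ → ℕ → ℝ) (r : ℤ) (m : ℕ) (x : ℝ) :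
    chebExpansion c r m x - chebExpansion d r m x =
      chebExpansion (fun t s => c t s - d t s) r m x := by
  simp only [chebExpansion, ← Finset.sum_sub_distrib, sub_mul]

theorem mul_chebExpansion (a : ℝ) (c : ℕ → ℕ → ℝ) (r : ℤ) (m : ℕ) (x : ℝ) :
    a * chebExpansion c r m x = chebExpansion (fun t s => a * c t s) r m x := by
  simp only [chebExpansion, Finset.mul_sum, mul_assoc]

theorem chebExpansion_congr {c d : ℕ → ℕ → ℝ} (r : ℤ) {m : ℕ} (x : ℝ)
    (h : ∀ t s, t + s = m → c t s = d t s) : chebExpansion c r m x = chebExpansion d r m x :=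
  Finset.sum_congr rfl fun p hp => by rw [h _ _ (Finset.HasAntidiagonal.mem_antidiagonal.1 hp)]

theorem chebSum_eq_chebExpansion (N m n : ℕ) (x : ℝ) :
    chebSum N m n x = chebExpansion (fun t s => alpha N t (t + s) n) n m x := by
  rw [chebSum, chebExpansion, Finset.Nat.sum_antidiagonal_eq_sum_range_succ_mk]
  refine Finset.sum_congr rfl fun t ht => ?_
  have ht' : t ≤ m := by simp at ht; omega
  dsimp only
  rw [Nat.add_sub_cancel' ht', Nat.cast_sub ht']
  ring_nf

/-! ### Chebyshev expansion of (1 - x²)^m C^{(m+1)}_{n-m}. -/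

/-- The coefficients of `(1 - x^2)^m C_{n-m}^{(m+1)}(x)` in the Chebyshev expansion, up to a
factor which does not depend on the summation indices. -/
noncomputable def powMulCoeff (m n : ℕ) (t s : ℕ) : ℝ :=
  (-1) ^ s / ((t.factorial : ℝ) * (s.factorial : ℝ)) *
    (poch ((n : ℝ) - m + 1) s / poch ((n : ℝ) + 2) s)

/-- The coefficient form of `gegenbauer_contiguous` at α = m + 1, as needed for the induction in
`pow_mul_gegenbauer`. -/
theorem powMulCoeff_step (m n t s : ℕ) (h : t + s = m + 1) :
    ((n : ℝ) + 2) * (m + 1) * powMulCoeff (m + 1) (n + 1) t s =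
      ((n : ℝ) + 2) * shiftFst (powMulCoeff m n) t s -
        ((n : ℝ) - m + 1) * (n - m + 2) / (n + 3) * shiftSnd (powMulCoeff m (n + 2)) t s := by
  have hm : (m : ℝ) = t + s - 1 := by
    have : (m : ℝ) + 1 = t + s := by exact_mod_cast h.symm
    linarith
  have e1 : ((n : ℝ) + 2) * poch ((n : ℝ) + 3) s = poch ((n : ℝ) + 2) s * (n + 2 + s) := by
    rw [← poch_succ, poch_succ_left]
    ring_nf
  have e2 : poch ((n : ℝ) + 3) s = poch ((n : ℝ) + 2) s * (n + 2 + s) / (n + 2) := by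
    field_simp
    linear_combination e1
  have hp := (poch_pos (show 0 < (n : ℝ) + 2 by positivity) s).ne'
  have a1 : ((n + 1 : ℕ) : ℝ) - (m + 1 : ℕ) + 1 = n - m + 1 := by push_cast; ring
  have a2 : ((n + 1 : ℕ) : ℝ) + 2 = n + 3 := by push_cast; ring
  have a3 : ((n + 2 : ℕ) : ℝ) - m + 1 = n - m + 3 := by push_cast; ring
  have a4 : ((n + 2 : ℕ) : ℝ) + 2 = n + 4 := by push_cast; ring
  have hs : (n : ℝ) + 2 + s ≠ 0 := by positivity
  -- The factor t absorbs the case t = 0; `hg` does the same with s.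
  have hf : shiftFst (powMulCoeff m n) t s = t * ((-1) ^ s / ((t.factorial : ℝ) * s.factorial) *
      (poch ((n : ℝ) - m + 1) s / poch ((n : ℝ) + 2) s)) := by
    cases t with
    | zero => simp [shiftFst]
    | succ t =>
      simp only [shiftFst, powMulCoeff, Nat.factorial_succ]
      push_cast
      field_simp
  have hg : ((n : ℝ) - m + 1) * (n - m + 2) / (n + 3) * shiftSnd (powMulCoeff m (n + 2)) t s =
      -(s * ((-1) ^ s / ((t.factorial : ℝ) * s.factorial) *
      (poch ((n : ℝ) - m + 1) s * (n - m + 1 + s) / poch ((n : ℝ) + 3) s))) := by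
    cases s with
    | zero => simp [shiftSnd]
    | succ s =>
      have hq := (poch_pos (show 0 < (n : ℝ) + 4 by positivity) s).ne'
      rw [← poch_succ, poch_succ_left, poch_succ_left, poch_succ_left ((n : ℝ) + 3)]
      simp only [shiftSnd, powMulCoeff, Nat.factorial_succ, a3, a4]
      rw [show (n : ℝ) - m + 1 + 1 = n - m + 2 by ring, show (n : ℝ) - m + 2 + 1 = n - m + 3 by ring,
        show (n : ℝ) + 3 + 1 = n + 4 by ring]
      push_cast
      field_simp
      ring
  rw [hf, hg, powMulCoeff, a1, a2, e2, hm]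
  field_simp
  ring

/-- Induction on m from C^{(1)}_n = U_n: the contiguous relation expresses the case (m + 1, n)
through (m, n - 1) and (m, n + 1). -/
theorem pow_mul_gegenbauer (m n : ℕ) (h : m ≤ n) (x : ℝ) :
    (1 - x ^ 2) ^ m * gegenbauer (m + 1) (n - m) x =
      ((n + m + 1).factorial : ℝ) / (((n + 1).factorial : ℝ) * 4 ^ m) *
        chebExpansion (powMulCoeff m n) n m x := by
  induction m generalizing n with
  | zero =>
    have h : ((n + 1).factorial : ℝ) ≠ 0 := by positivity
    simp [gegenbauer_one_eq_chebU, chebExpansion, powMulCoeff, poch_zero, h]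
  | succ m ih =>
    obtain ⟨j, rfl⟩ := Nat.exists_eq_add_of_le' h
    have h1 := ih (j + m) (by omega)
    have h2 := ih (j + m + 2) (by omega)
    have hc := gegenbauer_contiguous (show (0 : ℝ) < m + 1 by positivity) x j
    rw [show j + m - m = j by omega] at h1
    rw [show j + m + 2 - m = j + 2 by omega] at h2
    rw [show j + (m + 1) - (m + 1) = j by omega]
    have hs : ((j + m : ℕ) + 2 : ℝ) * (m + 1) *
        chebExpansion (powMulCoeff (m + 1) (j + m + 1)) ((j + m + 1 : ℕ) : ℤ) (m + 1) x =
        ((j + m : ℕ) + 2 : ℝ) * chebExpansion (powMulCoeff m (j + m)) ((j + m : ℕ) : ℤ) m x +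
        (-(((j + m : ℕ) : ℝ) - m + 1) * ((j + m : ℕ) - m + 2) / ((j + m : ℕ) + 3)) *
          chebExpansion (powMulCoeff m (j + m + 2)) ((j + m + 2 : ℕ) : ℤ) m x := by
      rw [show ((j + m : ℕ) : ℤ) = ((j + m + 1 : ℕ) : ℤ) - 1 by push_cast; ring,
        show ((j + m + 2 : ℕ) : ℤ) = ((j + m + 1 : ℕ) : ℤ) + 1 by push_cast; ring,
        ← chebExpansion_shiftFst, ← chebExpansion_shiftSnd, mul_chebExpansion, mul_chebExpansion,
        mul_chebExpansion, chebExpansion_add]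
      refine chebExpansion_congr _ _ fun t s hts => ?_
      rw [powMulCoeff_step m (j + m) t s hts]
      ring
    have hk : 4 * ((m : ℝ) + 1) * (j + (m + 1) + 1) ≠ 0 := by positivity
    apply mul_left_cancel₀ hk
    have hk' : ((j + m : ℕ) + 2 : ℝ) * (m + 1) ≠ 0 := by positivity
    rw [mul_comm, ← eq_div_iff hk'] at hs
    simp only [show j + (m + 1) = j + m + 1 by ring, Nat.cast_add_one m] at *
    rw [hs]
    generalize chebExpansion (powMulCoeff m (j + m)) _ m x = A at *
    generalize chebExpansion (powMulCoeff m (j + m + 2)) _ m x = B at *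
    have : 4 * ((m : ℝ) + 1) * (j + (m + 1) + 1) * ((1 - x ^ 2) ^ (m + 1) *
        gegenbauer ((m : ℝ) + 1 + 1) j x) =
        (j + 2 * ((m : ℝ) + 1)) * (j + 2 * (m + 1) + 1) *
          ((1 - x ^ 2) ^ m * gegenbauer (m + 1) j x) -
        (j + 1) * (j + 2) * ((1 - x ^ 2) ^ m * gegenbauer (m + 1) (j + 2) x) := by
      rw [pow_succ]
      linear_combination (1 - x ^ 2) ^ m * hc
    rw [this, h1, h2, show j + m + 1 + (m + 1) + 1 = j + m + m + 1 + 1 + 1 by ring,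
      show j + m + 2 + m + 1 = j + m + m + 1 + 1 + 1 by ring]
    simp only [Nat.factorial_succ]
    push_cast
    field_simp
    ring

/-! ### Recurrences of α_t(m, n) in N. -/

/-- The coefficient `alpha` in terms of factorials. -/
theorem alpha_eq (N m t s d e : ℕ) (n : ℕ) (hN : N = t + s + d) (hm : m = t + s)
    (he : e = s + d + 1) :
    alpha N t m n =
      ((N : ℝ) + 1) ^ 2 * (d.factorial : ℝ) * (m.factorial : ℝ) /
        ((n + 1) * (e.factorial : ℝ) * (t.factorial : ℝ)) * (-1) ^ s *
        (poch ((n : ℝ) - N) s / poch ((n : ℝ) + 2) s) := by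
  have h : poch ((N : ℝ) + 2 - t) t = ((N + 1).factorial : ℝ) / (e.factorial : ℝ) := by
    rw [show (N : ℝ) + 2 - t = (e : ℝ) + 1 by rw [hN, he]; push_cast; ring,
      poch_natCast_succ, show e + t = N + 1 by omega]
  rw [alpha, h, Nat.factorial_succ N, show N - m = d by omega, show m - t = s by omega]
  have : (N.factorial : ℝ) ≠ 0 := by positivity
  push_cast
  field_simp

/-- The recurrence of the coefficients `alpha` in `N`. -/
theorem alpha_step (N m t s n : ℕ) (hN : m ≤ N) (hm : t + s = m) :
    ((N : ℝ) + 1) ^ 2 * alpha (N + 1) t m n =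
      (((N : ℝ) + 1) * (N + 2) - (m : ℝ) * (m + 1)) * alpha N t m n +
      (m : ℝ) ^ 2 * (shiftFst (fun t s => alpha N t (t + s) n) t s +
          shiftSnd (fun t s => alpha N t (t + s) n) t s) -
      (m : ℝ) * (m - 1) * shiftFst (shiftSnd (fun t s => alpha N t (t + s) n)) t s := by
  obtain ⟨d, hd⟩ := Nat.exists_eq_add_of_le hN
  subst hm
  have hNd : (N : ℝ) = t + s + d := by exact_mod_cast hd
  rcases s with _ | s
  · have h1 := alpha_eq (N + 1) (t + 0) t 0 (d + 1) (d + 1 + 1) n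
      (by omega) (by omega) (by omega)
    have h2 := alpha_eq N (t + 0) t 0 d (d + 1) n (by omega) (by omega) (by omega)
    -- Here m = t; one of the two factors m makes the formula valid at t = 0 as well.
    have h3 : (t : ℝ) * shiftFst (fun t s => alpha N t (t + s) n) t 0 =
        ((N : ℝ) + 1) ^ 2 * (d + 1).factorial * t.factorial /
          ((n + 1) * (d + 1 + 1).factorial * t.factorial) * t := by
      rcases t with _ | t
      · simp [shiftFst]
      · simp only [shiftFst]
        rw [alpha_eq N (t + 0) t 0 (d + 1) (d + 1 + 1) n (by omega) (by omega) (by omega)]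
        simp only [poch_zero, Nat.factorial_succ, add_zero]
        push_cast
        field_simp
    have h4 : shiftFst (shiftSnd (fun t s => alpha N t (t + s) n)) t 0 = 0 := by
      rcases t with _ | t <;> simp [shiftFst, shiftSnd]
    rw [h1, h2, h4]
    simp only [poch_zero, Nat.factorial_succ, add_zero, shiftSnd] at h3 ⊢
    push_cast at h3 hNd ⊢
    rw [pow_two (t : ℝ), mul_assoc (t : ℝ), h3, hNd]
    field_simp
    ring
  · have hp := (poch_pos (show 0 < (n : ℝ) + 2 by positivity) s).ne'
    have e1 : poch ((n : ℝ) - (N + 1)) (s + 1) = (n - N - 1) * poch (n - N) s := by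
      rw [poch_succ_left]
      ring_nf
    have h1 := alpha_eq (N + 1) (t + (s + 1)) t (s + 1) (d + 1) (s + d + 1 + 1 + 1) n
      (by omega) (by omega) (by omega)
    have h2 := alpha_eq N (t + (s + 1)) t (s + 1) d (s + d + 1 + 1) n
      (by omega) (by omega) (by omega)
    have h3 := alpha_eq N (t + s) t s (d + 1) (s + d + 1 + 1) n (by omega) (by omega) (by omega)
    have h4 : shiftFst (fun t s => alpha N t (t + s) n) t (s + 1) =
        ((N : ℝ) + 1) ^ 2 * (d + 1).factorial * (t + s).factorial /
          ((n + 1) * (s + d + 1 + 1 + 1).factorial * t.factorial) * t * (-1) ^ (s + 1) *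
          (poch (n - N) (s + 1) / poch (n + 2) (s + 1)) := by
      rcases t with _ | t
      · simp [shiftFst]
      · simp only [shiftFst]
        rw [alpha_eq N (t + (s + 1)) t (s + 1) (d + 1) (s + d + 1 + 1 + 1) n
          (by omega) (by omega) (by omega), show t + (s + 1) = t + 1 + s by ring]
        simp only [Nat.factorial_succ]
        push_cast
        field_simp
    -- The factor m - 1 = t + s completes (t + s - 1)! to (t + s)!, and the case t = 0 needs no
    -- exception.
    have h5 : ((t + s : ℕ) : ℝ) * shiftFst (shiftSnd (fun t s => alpha N t (t + s) n)) t (s + 1) =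
        ((N : ℝ) + 1) ^ 2 * (d + 1 + 1).factorial * (t + s).factorial /
          ((n + 1) * (s + d + 1 + 1 + 1).factorial * t.factorial) * t * (-1) ^ s *
          (poch (n - N) s / poch (n + 2) s) := by
      rcases t with _ | t
      · simp [shiftFst]
      · simp only [shiftFst, shiftSnd]
        rw [alpha_eq N (t + s) t s (d + 1 + 1) (s + d + 1 + 1 + 1) n
          (by omega) (by omega) (by omega), show t + 1 + s = t + s + 1 by ring]
        simp only [Nat.factorial_succ]
        push_cast
        field_simp
    have hm : ((t + (s + 1) : ℕ) : ℝ) - 1 = (t + s : ℕ) := by push_cast; ring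
    rw [hm, mul_assoc _ _ (shiftFst (shiftSnd _) _ _), h5, h4, h1, h2]
    simp only [shiftSnd]
    rw [h3, Nat.cast_add_one N, e1, poch_succ, poch_succ, ← add_assoc]
    generalize poch ((n : ℝ) - N) s = P at *
    simp only [Nat.factorial_succ]
    push_cast at hNd ⊢
    rw [hNd]
    field_simp
    ring

/-- The recurrence of the coefficients `alpha` that raises `m = N`. -/
theorem alpha_succ_diag (N t s n : ℕ) (hm : t + s = N + 1) :
    ((N : ℝ) + 1) ^ 2 * alpha (N + 1) t (N + 1) n =
      ((N : ℝ) + 1) ^ 2 * (shiftFst (fun t s => alpha N t (t + s) n) t s +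
          shiftSnd (fun t s => alpha N t (t + s) n) t s) -
      ((N : ℝ) + 1) * N * shiftFst (shiftSnd (fun t s => alpha N t (t + s) n)) t s +
      ((N : ℝ) + 1) ^ 2 * ((2 * N + 3) * (N + 1).factorial / (n + 1) *
        powMulCoeff (N + 1) n t s) := by
  have e0 : (n : ℝ) - (N + 1 : ℕ) + 1 = n - N := by push_cast; ring
  rcases s with _ | s
  · obtain rfl : t = N + 1 := by omega
    simp only [shiftFst, shiftSnd]
    rw [alpha_eq (N + 1) (N + 1) (N + 1) 0 0 1 n (by omega) (by omega) (by omega),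
      alpha_eq N (N + 0) N 0 0 1 n (by omega) (by omega) (by omega)]
    simp only [powMulCoeff, poch_zero, Nat.factorial_succ, Nat.factorial_zero, add_zero]
    push_cast
    field_simp
    ring
  · obtain rfl : N = t + s := by omega
    have hp := (poch_pos (show 0 < (n : ℝ) + 2 by positivity) s).ne'
    have e1 : poch ((n : ℝ) - (t + s + 1 : ℕ)) (s + 1) =
        (n - (t + s : ℕ) - 1) * poch (n - (t + s : ℕ)) s := by
      rw [poch_succ_left]
      push_cast
      ring_nf
    have h4 : shiftFst (fun t' s' => alpha (t + s) t' (t' + s') n) t (s + 1) =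
        ((t + s : ℕ) + 1 : ℝ) ^ 2 * (t + s).factorial /
          ((n + 1) * (s + 1 + 1).factorial * t.factorial) * t * (-1) ^ (s + 1) *
          (poch (n - (t + s : ℕ)) (s + 1) / poch (n + 2) (s + 1)) := by
      rcases t with _ | t
      · simp [shiftFst]
      · simp only [shiftFst]
        rw [alpha_eq (t + 1 + s) (t + (s + 1)) t (s + 1) 0 (s + 1 + 1) n
          (by omega) (by omega) (by omega), show t + (s + 1) = t + 1 + s by ring]
        simp only [Nat.factorial_succ, Nat.factorial_zero]
        push_cast
        field_simp
    have h5 : ((t + s : ℕ) : ℝ) *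
          shiftFst (shiftSnd (fun t' s' => alpha (t + s) t' (t' + s') n)) t (s + 1) =
        ((t + s : ℕ) + 1 : ℝ) ^ 2 * (t + s).factorial /
          ((n + 1) * (s + 1 + 1).factorial * t.factorial) * t * (-1) ^ s *
          (poch (n - (t + s : ℕ)) s / poch (n + 2) s) := by
      rcases t with _ | t
      · simp [shiftFst]
      · simp only [shiftFst, shiftSnd]
        rw [alpha_eq (t + 1 + s) (t + s) t s 1 (s + 1 + 1) n
          (by omega) (by omega) (by omega), show t + 1 + s = t + s + 1 by ring]
        simp only [Nat.factorial_succ, Nat.factorial_zero]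
        push_cast
        field_simp
    rw [mul_assoc _ _ (shiftFst (shiftSnd _) _ _), h5, h4,
      alpha_eq (t + s + 1) (t + s + 1) t (s + 1) 0 (s + 1 + 1) n (by omega) (by omega) (by omega)]
    simp only [shiftSnd, powMulCoeff]
    rw [alpha_eq (t + s) (t + s) t s 0 (s + 1) n (by omega) (by omega) (by omega), e1, e0,
      poch_succ, poch_succ]
    generalize poch ((n : ℝ) - (t + s : ℕ)) s = P at *
    simp only [Nat.factorial_succ, Nat.factorial_zero]
    push_cast
    field_simp
    ring

/-! ### The Gegenbauer sum and its recurrence in N. -/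

/-- The Gegenbauer polynomial `C_{m-k}^{(k+1)}(x)` with the normalization `m! / (m + k + 1)!`,
extended by zero to `m < k`. -/
noncomputable def scaledGegenbauer (k m : ℕ) (x : ℝ) : ℝ :=
  if k ≤ m then
    (m.factorial : ℝ) / ((m + k + 1).factorial : ℝ) * gegenbauer ((k : ℝ) + 1) (m - k) x
  else 0

theorem scaledGegenbauer_of_lt {k m : ℕ} (h : m < k) (x : ℝ) : scaledGegenbauer k m x = 0 :=
  if_neg (by omega)

theorem scaledGegenbauer_add (k j : ℕ) (x : ℝ) :
    scaledGegenbauer k (j + k) x =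
      ((j + k).factorial : ℝ) / ((j + k + k + 1).factorial : ℝ) * gegenbauer ((k : ℝ) + 1) j x := by
  rw [scaledGegenbauer, if_pos (by omega), Nat.add_sub_cancel]

/-- The normalization confines k to the term k(k+1) on the left, so the relation can be summed over
k. -/
theorem scaledGegenbauer_recurrence (k m : ℕ) (x : ℝ) :
    (((m : ℝ) + 1) * (m + 2) - k * (k + 1)) * scaledGegenbauer k (m + 1) x =
      2 * ((m : ℝ) + 1) ^ 2 * x * scaledGegenbauer k m x -
        ((m : ℝ) + 1) * m * scaledGegenbauer k (m - 1) x := by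
  have hk : (0 : ℝ) < k + 1 := by positivity
  rcases lt_trichotomy (m + 1) k with h | h | h
  · rw [scaledGegenbauer_of_lt h, scaledGegenbauer_of_lt (by omega),
      scaledGegenbauer_of_lt (by omega)]
    ring
  -- For m + 1 = k the left factor vanishes, although the polynomial does not.
  · rw [scaledGegenbauer_of_lt (show m < k by omega),
      scaledGegenbauer_of_lt (show m - 1 < k by omega), ← h]
    push_cast
    ring
  · obtain ⟨j, rfl⟩ := Nat.exists_eq_add_of_le' (Nat.lt_succ_iff.1 h)
    rcases j with _ | j
    · have h1 := scaledGegenbauer_add k 1 x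
      have h0 := scaledGegenbauer_add k 0 x
      have h2 : (k : ℝ) * scaledGegenbauer k (0 + k - 1) x = 0 := by
        rcases k with _ | k
        · simp
        · rw [scaledGegenbauer_of_lt (by omega), mul_zero]
      rw [show 0 + k + 1 = 1 + k by ring, h1, h0, show 0 + k = k by ring] at *
      rw [mul_assoc _ (k : ℝ), h2, gegenbauer_zero, gegenbauer_one hk,
        show 1 + k + k + 1 = k + k + 1 + 1 by ring, show 1 + k = k + 1 by ring]
      simp only [Nat.factorial_succ]
      push_cast
      field_simp
      ring
    · rw [show j + 1 + k - 1 = j + k by omega, show j + 1 + k + 1 = j + 2 + k by ring,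
        scaledGegenbauer_add, scaledGegenbauer_add, scaledGegenbauer_add]
      have hr := gegenbauer_recurrence hk j x
      rw [mul_comm, ← eq_div_iff (show (j : ℝ) + 2 ≠ 0 by positivity)] at hr
      rw [hr, show j + 2 + k + k + 1 = j + k + k + 1 + 1 + 1 by ring,
        show j + 1 + k + k + 1 = j + k + k + 1 + 1 by ring, show j + 2 + k = j + k + 1 + 1 by ring,
        show j + 1 + k = j + k + 1 by ring]
      simp only [Nat.factorial_succ]
      push_cast
      field_simp
      ring

/-- The factors of `beta` which depend on `N`. -/
noncomputable def sizeFactor (N k : ℕ) : ℝ :=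
  ((N + k + 1).factorial : ℝ) * ((N - k).factorial : ℝ) / ((N.factorial : ℝ) * (N.factorial : ℝ))

/-- The factor is (N + k + 2)(N + 1 - k), with the same k(k+1) as in `scaledGegenbauer_recurrence`.
-/
theorem sizeFactor_succ {N k : ℕ} (h : k ≤ N) :
    ((N : ℝ) + 1) ^ 2 * sizeFactor (N + 1) k =
      (((N : ℝ) + 1) * (N + 2) - k * (k + 1)) * sizeFactor N k := by
  obtain ⟨d, rfl⟩ := Nat.exists_eq_add_of_le' h
  rw [sizeFactor, sizeFactor, show d + k + 1 - k = d + 1 by omega, Nat.add_sub_cancel,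
    show d + k + 1 + k + 1 = d + k + k + 1 + 1 by ring]
  simp only [Nat.factorial_succ]
  push_cast
  field_simp
  ring

/-- The factors of `beta` and the powers of `1 - x^2` which only depend on `k`. -/
noncomputable def levelFactor (k : ℕ) (x : ℝ) : ℝ :=
  (k.factorial : ℝ) * (k.factorial : ℝ) * (2 : ℝ) ^ (2 * k) * (2 * (k : ℝ) + 1) * (1 - x ^ 2) ^ k

/-- The `LDU` expansion `∑_{k=0}^m β_k(m, n) (1 - x²)^k C_{n-k}^{(k+1)}(x) C_{m-k}^{(k+1)}(x)`. -/
noncomputable def gegenbauerSum (N m n : ℕ) (x : ℝ) : ℝ :=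
  ∑ k ∈ Finset.range (m + 1),
    sizeFactor N k * levelFactor k x * scaledGegenbauer k n x * scaledGegenbauer k m x

theorem gegenbauerSum_eq_sum_range {N m n K : ℕ} (x : ℝ) (h : m < K) :
    gegenbauerSum N m n x = ∑ k ∈ Finset.range K,
      sizeFactor N k * levelFactor k x * scaledGegenbauer k n x * scaledGegenbauer k m x := by
  refine Finset.sum_subset (by simpa using h) fun k _ hk => ?_
  rw [scaledGegenbauer_of_lt (show m < k by simpa using hk), mul_zero]

theorem gegenbauerSum_eq {N m n : ℕ} (h : m ≤ n) (x : ℝ) :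
    gegenbauerSum N m n x = ∑ k ∈ Finset.range (m + 1),
      beta N k m n * (1 - x ^ 2) ^ k * gegenbauer ((k : ℝ) + 1) (n - k) x *
        gegenbauer ((k : ℝ) + 1) (m - k) x := by
  refine Finset.sum_congr rfl fun k hk => ?_
  have hk' : k ≤ m := by simp at hk; omega
  rw [scaledGegenbauer, scaledGegenbauer, if_pos hk', if_pos (hk'.trans h), beta, sizeFactor,
    levelFactor]
  ring

theorem gegenbauerSum_step (N m n : ℕ) (x : ℝ) :
    2 * ((m : ℝ) + 1) ^ 2 * x * gegenbauerSum N m n x -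
        ((m : ℝ) + 1) * m * gegenbauerSum N (m - 1) n x =
      ∑ k ∈ Finset.range (m + 1), (((m : ℝ) + 1) * (m + 2) - k * (k + 1)) *
        (sizeFactor N k * levelFactor k x * scaledGegenbauer k n x *
          scaledGegenbauer k (m + 1) x) := by
  rw [gegenbauerSum_eq_sum_range x (show m < m + 1 by omega),
    gegenbauerSum_eq_sum_range x (show m - 1 < m + 1 by omega), Finset.mul_sum, Finset.mul_sum,
    ← Finset.sum_sub_distrib]
  refine Finset.sum_congr rfl fun k _ => ?_
  linear_combination -sizeFactor N k * levelFactor k x * scaledGegenbauer k n x *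
    scaledGegenbauer_recurrence k m x

theorem gegenbauerSum_succ_size (N m n : ℕ) (h : m + 1 ≤ N) (x : ℝ) :
    ((N : ℝ) + 1) ^ 2 * gegenbauerSum (N + 1) (m + 1) n x =
      (((N : ℝ) + 1) * (N + 2) - (m + 1) * (m + 2)) * gegenbauerSum N (m + 1) n x +
      (2 * ((m : ℝ) + 1) ^ 2 * x * gegenbauerSum N m n x -
        ((m : ℝ) + 1) * m * gegenbauerSum N (m - 1) n x) := by
  rw [gegenbauerSum_step, gegenbauerSum, gegenbauerSum, Finset.sum_range_succ,
    Finset.sum_range_succ _ (m + 1), mul_add, mul_add, Finset.mul_sum, Finset.mul_sum,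
    add_right_comm, ← Finset.sum_add_distrib]
  congr 1
  · refine Finset.sum_congr rfl fun k hk => ?_
    have hk' : k ≤ N := by simp at hk; omega
    linear_combination levelFactor k x * scaledGegenbauer k n x *
      scaledGegenbauer k (m + 1) x * sizeFactor_succ hk'
  · have := sizeFactor_succ h
    push_cast at this
    linear_combination levelFactor (m + 1) x * scaledGegenbauer (m + 1) n x *
      scaledGegenbauer (m + 1) (m + 1) x * this

theorem gegenbauerSum_zero_succ_size (N n : ℕ) (x : ℝ) :
    ((N : ℝ) + 1) ^ 2 * gegenbauerSum (N + 1) 0 n x =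
      (((N : ℝ) + 1) * (N + 2)) * gegenbauerSum N 0 n x := by
  have := sizeFactor_succ (Nat.zero_le N)
  simp only [Nat.cast_zero, zero_mul, sub_zero] at this
  simp only [gegenbauerSum, zero_add, Finset.sum_range_one]
  linear_combination levelFactor 0 x * scaledGegenbauer 0 n x * scaledGegenbauer 0 0 x * this

/-- The terms k ≤ N follow the recurrence; k = N + 1 has no counterpart at size N and is supplied by
`pow_mul_gegenbauer`. -/
theorem gegenbauerSum_succ_diag (N n : ℕ) (h : N + 1 ≤ n) (x : ℝ) :
    ((N : ℝ) + 1) ^ 2 * gegenbauerSum (N + 1) (N + 1) n x =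
      2 * ((N : ℝ) + 1) ^ 2 * x * gegenbauerSum N N n x -
        ((N : ℝ) + 1) * N * gegenbauerSum N (N - 1) n x +
      ((N : ℝ) + 1) ^ 2 * ((2 * N + 3) * (N + 1).factorial / (n + 1)) *
        chebExpansion (powMulCoeff (N + 1) n) n (N + 1) x := by
  rw [gegenbauerSum_step, gegenbauerSum, Finset.sum_range_succ, mul_add,
    Finset.mul_sum]
  congr 1
  · refine Finset.sum_congr rfl fun k hk => ?_
    have hk' : k ≤ N := by simp at hk; omega
    linear_combination levelFactor k x * scaledGegenbauer k n x *
      scaledGegenbauer k (N + 1) x * sizeFactor_succ hk'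
  · have hp := pow_mul_gegenbauer (N + 1) n h x
    have e : (2 : ℝ) ^ (2 * (N + 1)) = 4 ^ (N + 1) := by rw [pow_mul]; norm_num
    rw [scaledGegenbauer, scaledGegenbauer, if_pos le_rfl, if_pos h, Nat.sub_self, gegenbauer_zero,
      levelFactor, sizeFactor, Nat.sub_self, Nat.factorial_zero, e]
    have hE : chebExpansion (powMulCoeff (N + 1) n) n (N + 1) x =
        (((n + 1).factorial : ℝ) * 4 ^ (N + 1)) / ((n + (N + 1) + 1).factorial : ℝ) *
        ((1 - x ^ 2) ^ (N + 1) * gegenbauer ((N + 1 : ℕ) + 1) (n - (N + 1)) x) := by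
      rw [hp]
      field_simp
    rw [hE, Nat.factorial_succ n]
    push_cast
    field_simp
    ring

/-! ### The same recurrences for the Chebyshev sum, and the identity (b). -/

theorem chebSum_succ_size (N m n : ℕ) (h : m + 1 ≤ N) (x : ℝ) :
    ((N : ℝ) + 1) ^ 2 * chebSum (N + 1) (m + 1) n x =
      (((N : ℝ) + 1) * (N + 2) - (m + 1) * (m + 2)) * chebSum N (m + 1) n x +
      (2 * ((m : ℝ) + 1) ^ 2 * x * chebSum N m n x -
        ((m : ℝ) + 1) * m * chebSum N (m - 1) n x) := by
  simp only [chebSum_eq_chebExpansion]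
  rw [show 2 * ((m : ℝ) + 1) ^ 2 * x * chebExpansion (fun t s => alpha N t (t + s) n) n m x =
    ((m : ℝ) + 1) ^ 2 * (2 * x * chebExpansion (fun t s => alpha N t (t + s) n) n m x) by ring,
    two_mul_chebExpansion, mul_assoc _ (m : ℝ), natCast_mul_chebExpansion_pred,
    ← mul_assoc _ (m : ℝ), chebExpansion_add]
  simp only [mul_chebExpansion, chebExpansion_add, chebExpansion_sub]
  refine chebExpansion_congr _ _ fun t s hts => ?_
  have := alpha_step N (m + 1) t s n h hts
  simp only [hts]
  push_cast at this
  linear_combination this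

theorem chebSum_zero_succ_size (N n : ℕ) (x : ℝ) :
    ((N : ℝ) + 1) ^ 2 * chebSum (N + 1) 0 n x =
      (((N : ℝ) + 1) * (N + 2)) * chebSum N 0 n x := by
  have := alpha_step N 0 0 0 n (Nat.zero_le N) rfl
  simp only [Nat.cast_zero, zero_mul, sub_zero] at this
  simp only [chebSum, zero_add, Finset.sum_range_one]
  linear_combination chebU (n + (0 : ℕ) - 2 * (0 : ℕ)) x * this

theorem chebSum_succ_diag (N n : ℕ) (x : ℝ) :
    ((N : ℝ) + 1) ^ 2 * chebSum (N + 1) (N + 1) n x =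
      2 * ((N : ℝ) + 1) ^ 2 * x * chebSum N N n x -
        ((N : ℝ) + 1) * N * chebSum N (N - 1) n x +
      ((N : ℝ) + 1) ^ 2 * ((2 * N + 3) * (N + 1).factorial / (n + 1)) *
        chebExpansion (powMulCoeff (N + 1) n) n (N + 1) x := by
  simp only [chebSum_eq_chebExpansion]
  rw [show 2 * ((N : ℝ) + 1) ^ 2 * x * chebExpansion (fun t s => alpha N t (t + s) n) n N x =
    ((N : ℝ) + 1) ^ 2 * (2 * x * chebExpansion (fun t s => alpha N t (t + s) n) n N x) by ring,
    two_mul_chebExpansion, mul_assoc _ (N : ℝ), natCast_mul_chebExpansion_pred,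
    ← mul_assoc _ (N : ℝ), chebExpansion_add]
  simp only [mul_chebExpansion, chebExpansion_add, chebExpansion_sub]
  refine chebExpansion_congr _ _ fun t s hts => ?_
  have := alpha_succ_diag N t s n hts
  simp only [hts]
  linear_combination this

theorem chebSum_eq_gegenbauerSum (N m n : ℕ) (hN : m ≤ N) (hn : m ≤ n) (x : ℝ) :
    chebSum N m n x = gegenbauerSum N m n x := by
  -- No bound n ≤ N is imposed: the diagonal step to N + 1 uses size N with n ≥ N + 1.
  induction N generalizing m with
  | zero =>
    obtain rfl : m = 0 := by omega
    simp only [chebSum, gegenbauerSum, zero_add, Finset.sum_range_one, sizeFactor, levelFactor,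
      scaledGegenbauer, alpha, poch_zero, Nat.zero_le, if_true, gegenbauer_zero, Nat.sub_zero,
      Nat.factorial_succ, add_zero, Nat.cast_zero, mul_zero, sub_zero, gegenbauer_one_eq_chebU]
    have : (n.factorial : ℝ) ≠ 0 := by positivity
    norm_num
    field_simp
    simp
  | succ N ih =>
    have hk : ((N : ℝ) + 1) ^ 2 ≠ 0 := by positivity
    apply mul_left_cancel₀ hk
    rcases m with _ | m
    · rw [chebSum_zero_succ_size, gegenbauerSum_zero_succ_size, ih 0 (by omega) hn]
    · rcases Nat.lt_or_ge m N with h | h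
      · rw [chebSum_succ_size N m n h, gegenbauerSum_succ_size N m n h,
          ih (m + 1) h hn, ih m (by omega) (by omega), ih (m - 1) (by omega) (by omega)]
      · obtain rfl : m = N := by omega
        rw [chebSum_succ_diag, gegenbauerSum_succ_diag m n hn,
          ih m (by omega) (by omega), ih (m - 1) (by omega) (by omega)]

/-! ### The matrix factorization (a). -/

theorem entryL_of_lt {m k : ℕ} (h : m < k) (x : ℝ) : entryL m k x = 0 := if_neg (by omega)

theorem entryL_self (m : ℕ) (x : ℝ) : entryL m m x = 1 := by
  rw [entryL, if_pos le_rfl, Nat.sub_self, gegenbauer_zero, ← two_mul]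
  field_simp

theorem entryL_eq_scaledGegenbauer (m k : ℕ) (x : ℝ) :
    entryL m k x = ((2 * k + 1).factorial : ℝ) / (k.factorial : ℝ) * scaledGegenbauer k m x := by
  rw [entryL, scaledGegenbauer]
  split_ifs
  · field_simp
  · simp

/-- The two factors (2k+1)!/k! from L cancel against c_k(ℓ), leaving `sizeFactor` times
`levelFactor`. -/
theorem sum_entryL_mul {N m n : ℕ} (h : m ≤ N) (x : ℝ) :
    ∑ k ∈ Finset.range (N + 1),
      entryL n k x * (coeffC N k * (1 - x ^ 2) ^ k) * entryL m k x = gegenbauerSum N m n x := by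
  rw [gegenbauerSum_eq_sum_range x (show m < N + 1 by omega)]
  refine Finset.sum_congr rfl fun k _ => ?_
  rw [entryL_eq_scaledGegenbauer, entryL_eq_scaledGegenbauer, coeffC, sizeFactor, levelFactor,
    pow_mul, show (2 : ℝ) ^ 2 = 4 by norm_num]
  field_simp

theorem weightEntry_eq {N n m : ℕ} (hn : n ≤ N) (hm : m ≤ N) (x : ℝ) :
    weightEntry N n m x = Real.sqrt (1 - x ^ 2) * ∑ k ∈ Finset.range (N + 1),
      entryL n k x * (coeffC N k * (1 - x ^ 2) ^ k) * entryL m k x := by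
  rw [weightEntry]
  congr 1
  split_ifs with h
  · rw [sum_entryL_mul hm, chebSum_eq_gegenbauerSum N m n hm h]
  · rw [chebSum_eq_gegenbauerSum N n m hn (by omega), ← sum_entryL_mul hn]
    exact Finset.sum_congr rfl fun k _ => by ring

theorem weight_eq (N : ℕ) (x : ℝ) :
    weight N x =
      ((Real.sqrt (1 - x ^ 2) : ℝ) : ℂ) • (matL N x * matT N x * (matL N x).transpose) := by
  ext n m
  rw [Matrix.smul_apply, Matrix.mul_apply]
  simp only [weight, matL, matT, Matrix.mul_diagonal, Matrix.of_apply, Matrix.transpose_apply,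
    smul_eq_mul]
  rw [weightEntry_eq (Nat.lt_succ_iff.1 n.2) (Nat.lt_succ_iff.1 m.2), Finset.sum_range]
  push_cast
  rfl

end MVChebyshev

theorem theorem2p1 (N : ℕ) :
    (∀ x ∈ Set.Icc (-1 : ℝ) 1,
      (∀ m k : Fin (N + 1), m < k → MVChebyshev.matL N x m k = 0) ∧
      (∀ m : Fin (N + 1), MVChebyshev.matL N x m m = 1) ∧
      MVChebyshev.weight N x =
        ((Real.sqrt (1 - x ^ 2) : ℝ) : ℂ) •
          (MVChebyshev.matL N x * MVChebyshev.matT N x * (MVChebyshev.matL N x).transpose)) ∧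
    (∀ m n : ℕ, m ≤ n → n ≤ N → ∀ x : ℝ,
      ∑ t ∈ Finset.range (m + 1),
          MVChebyshev.alpha N t m n *
            MVChebyshev.chebU ((n : ℤ) + (m : ℤ) - 2 * (t : ℤ)) x =
        ∑ k ∈ Finset.range (m + 1),
          MVChebyshev.beta N k m n * (1 - x ^ 2) ^ k *
            MVChebyshev.gegenbauer ((k : ℝ) + 1) (n - k) x *
            MVChebyshev.gegenbauer ((k : ℝ) + 1) (m - k) x) := by
  refine ⟨fun x _ => ⟨fun m k h => ?_, fun m => ?_, MVChebyshev.weight_eq N x⟩,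
    fun m n hmn hn x => ?_⟩
  · simp [MVChebyshev.matL, MVChebyshev.entryL_of_lt h]
  · simp [MVChebyshev.matL, MVChebyshev.entryL_self]
  · rw [← MVChebyshev.gegenbauerSum_eq hmn]
    exact MVChebyshev.chebSum_eq_gegenbauerSum N m n (hmn.trans hn) hmn x
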